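/- Let $g,n$ be positive integers, $N=gn$, and let $t\ge 0$ be an integer with $t<g$. For $0\le w\le N$ let $|D^N_w\rangle=\binom Nw^{-1/2}\sum_{x\in\{0,1\}^N,\ x_1+\dots+x_N=w}|x_1\rangle\otimes\dots\otimes|x_N\rangle$ be the Dicke states on $N$ qubits, and let $$|\varphi_1\rangle=\sqrt{2^{-n}}\sum_{j=0}^n\sqrt{\tbinom nj}\,|D^N_{gj}\rangle$$ be the gnu probe state. Let $\rho=\operatorname{tr}_t(|\varphi_1\rangle\langle\varphi_1|)$ be the state of the remaining $N-t$ qubits after the first $t$ qubits are traced out, and let $H=\sum_{i=1}^{N-t}Z_i$, where $Z_i$ is the Pauli operator $Z$ on qubit $i$. Denote by $$F(\rho,H)=2\sum_{k,l:\,p_k+p_l\neq0}\frac{(p_k-p_l)^2}{p_k+p_l}\,|\langle k|H|l\rangle|^2,\qquad \rho=\sum_k p_k|k\rangle\langle k|$$ ($\{|k\rangle\}$ an orthonormal eigenbasis of $\rho$) the quantum Fisher information (QFI) of $\rho$ with respect to the generator $H$. For $0\le u\le t$ and $1\le j\le n-1$ put $$a_{j,u}=\frac{\binom nj}{2^n}\frac{\binom{N-t}{gj-u}}{\binom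 N{gj}},\qquad b_{j,u}=\frac{4(gj-u)(N-t-gj+u)}{(N-t)(N-t-1)},\qquad c_{j,u}=\frac{2(gj-u)}{N-t},$$ $$A_u=\sum_{j=1}^{n-1}a_{j,u},\qquad B_u=\sum_{j=1}^{n-1}a_{j,u}b_{j,u},\qquad C_u=\sum_{j=1}^{n-1}a_{j,u}c_{j,u},$$ $$K_u=2A_uC_u-\Bigl(1-\frac1{N-t}\Bigr)A_uB_u-C_u^2 .$$ Then $$F(\rho,H)\ \ge\ \frac{2(N-t)^2}{2^n}\bigl(4A_t-B_0-B_t+2C_0-2C_t\bigr)+\frac{2(N-t)}{2^n}\bigl(B_0+B_t\bigr)+2(N-t)^2\sum_{u=0}^t\binom tu^2K_u .$$ -/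

import Mathlib

noncomputable section

namespace GnuProbe

open Finset

/-- Computational basis labels of `N` qubits; a vector of the `N`-qubit Hilbert space is a
function `Bits N → ℂ`, an operator is a matrix indexed by `Bits N`. -/
abbrev Bits (N : ℕ) : Type := Fin N → Fin 2

/-- The Hamming weight `x_1 + ... + x_N` of a bit string. -/
def weight {N : ℕ} (x : Bits N) : ℕ := ∑ i, (x i : ℕ)

/-- The Dicke state `|D^N_w⟩ = binom(N,w)^(-1/2) ∑_{x : x_1 + ... + x_N = w} |x⟩`. -/
def dicke (N w : ℕ) : Bits N → ℂ :=
  fun x => if weight x = w then ((1 / √(N.choose w : ℝ) : ℝ) : ℂ) else 0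

/-- The gnu probe state `2^(-n/2) ∑_{j=0}^n √binom(n,j) |D^N_{gj}⟩` on `N` qubits.
The parameter `u` of the family enters only through the number `N = gnu` of qubits. -/
def probe (g n N : ℕ) : Bits N → ℂ :=
  ∑ j ∈ range (n + 1), ((√(1 / 2 ^ n : ℝ) * √(n.choose j : ℝ) : ℝ) : ℂ) • dicke N (g * j)

/-- The rank-one operator `|ψ⟩⟨ψ|`. -/
def pureState {N : ℕ} (ψ : Bits N → ℂ) : Matrix (Bits N) (Bits N) ℂ :=
  Matrix.vecMulVec ψ (star ψ)

/-- For `t ≤ N`, the string of `N` bits with `x` in the first `t` places and `y` in the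
remaining `N - t` places. -/
def join {N t : ℕ} (x : Bits t) (y : Bits (N - t)) : Bits N :=
  fun i => if h : (i : ℕ) < t then x ⟨i, h⟩ else y ⟨(i : ℕ) - t, by omega⟩

/-- For `t ≤ N`, the partial trace over the first `t` of `N` qubits. -/
def traceFirst {N : ℕ} (t : ℕ) (σ : Matrix (Bits N) (Bits N) ℂ) :
    Matrix (Bits (N - t)) (Bits (N - t)) ℂ :=
  Matrix.of fun y y' => ∑ x : Bits t, σ (join x y) (join x y')

/-- The state of the remaining `N - t` qubits when the first `t` qubits of the probe state
are erased. -/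
def erased (g n N t : ℕ) : Matrix (Bits (N - t)) (Bits (N - t)) ℂ :=
  traceFirst t (pureState (probe g n N))

theorem erased_isHermitian (g n N t : ℕ) : (erased g n N t).IsHermitian := by
  ext y y'
  simp [erased, traceFirst, pureState, Matrix.vecMulVec_apply, Matrix.conjTranspose_apply,
    mul_comm]

/-- The Pauli operator `Z` on qubit `i`: it maps `|x⟩` to `(-1)^(x_i) |x⟩`. -/
def pauliZ {M : ℕ} (i : Fin M) : Matrix (Bits M) (Bits M) ℂ :=
  Matrix.diagonal fun x => (-1 : ℂ) ^ (x i : ℕ)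

/-- The generator `H = Z_1 + ... + Z_M`. -/
def generator (M : ℕ) : Matrix (Bits M) (Bits M) ℂ := ∑ i, pauliZ i

/-- The quantum Fisher information of the state `ρ` with respect to the generator `H`, that is
`2 ∑_{k,l : p_k + p_l ≠ 0} (p_k - p_l)^2 / (p_k + p_l) |⟨k|H|l⟩|^2`,
where `ρ = ∑_k p_k |k⟩⟨k|` is a spectral decomposition in an orthonormal basis. -/
def qfi {ι : Type*} [Fintype ι] [DecidableEq ι] {ρ : Matrix ι ι ℂ} (hρ : ρ.IsHermitian)
    (H : Matrix ι ι ℂ) : ℝ :=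
  2 * ∑ k, ∑ l,
    if hρ.eigenvalues k + hρ.eigenvalues l = 0 then 0
    else (hρ.eigenvalues k - hρ.eigenvalues l) ^ 2 / (hρ.eigenvalues k + hρ.eigenvalues l) *
      ‖(star (hρ.eigenvectorUnitary : Matrix ι ι ℂ) * H *
        (hρ.eigenvectorUnitary : Matrix ι ι ℂ)) k l‖ ^ 2

/-- `a_{j,u} = 2^(-n) binom(n,j) binom(N-t,gj-u) / binom(N,gj)`. It is used for
`u ≤ t < g ≤ gj` and `t ≤ N`, so no subtraction of natural numbers is truncated. -/
def a (g n N t j u : ℕ) : ℝ :=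
  (n.choose j : ℝ) / 2 ^ n * (((N - t).choose (g * j - u) : ℝ) / (N.choose (g * j) : ℝ))

def b (g N t j u : ℕ) : ℝ :=
  4 * ((g : ℝ) * j - u) * ((N : ℝ) - t - g * j + u) / (((N : ℝ) - t) * ((N : ℝ) - t - 1))

def c (g N t j u : ℕ) : ℝ :=
  2 * ((g : ℝ) * j - u) / ((N : ℝ) - t)

def A (g n N t u : ℕ) : ℝ := ∑ j ∈ Ico 1 n, a g n N t j u

def B (g n N t u : ℕ) : ℝ := ∑ j ∈ Ico 1 n, a g n N t j u * b g N t j u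

def C (g n N t u : ℕ) : ℝ := ∑ j ∈ Ico 1 n, a g n N t j u * c g N t j u

def K (g n N t u : ℕ) : ℝ :=
  2 * A g n N t u * C g n N t u
    - (1 - 1 / ((N : ℝ) - t)) * A g n N t u * B g n N t u - C g n N t u ^ 2

end GnuProbe

end

/-!
The bound needs no diagonalisation of the erased state `ρ`. As `ρ` is positive semidefinite of
trace at most one, `p_k + p_l ≤ 1` for any two indices `k ≠ l`. Dropping the denominators
in the quantum Fisher information therefore gives `F(ρ, H) ≥ 2 ‖ρH - Hρ‖²` in the Hilbert-Schmidt
norm, a quantity that can be read off in the computational basis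
(`two_mul_sum_norm_commutator_sq_le_qfi`).

There `H` is diagonal with entries `N - t - 2 |y|`, where `|y|` is the Hamming weight, and the
entries of `ρ` are real and nonnegative: with `r` the amplitude of the probe state as a function
of the weight, `ρ_{y,y'} = ∑_u binom(t,u) r(u + |y|) r(u + |y'|)`. The square of a sum of
nonnegative numbers is at least the sum of the squares, so `F(ρ, H)` is at least
`8 ∑_u binom(t,u)² ∑_{y,y'} r(u + |y|)² r(u + |y'|)² (|y| - |y'|)²`
(`sum_choose_sq_mul_le_qfi`).

For fixed `u`, the weights `gj - u` with `1 ≤ j ≤ n - 1` carry the masses `a_{j,u}`, and there is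
a further mass `2^(-n)` at weight `0` if `u = 0` and at weight `N - t` if `u = t`
(`le_sum_choose_mul_amplitude_sq`). The pairs of interior weights contribute
`((N - t)² / 2) K_u`, a variance in disguise (`sum_sum_a_mul_sq_sub`); the pairs of one interior
weight and one extreme weight contribute second moments about `0` and about `N - t`, which are the
terms outside the sum over `u` (`sum_a_mul_weight_sq`, `sum_a_mul_coweight_sq`). The lower bound
obtained in this way is twice the claimed one.
-/

noncomputable section
namespace GnuProbe
open Finset
open scoped ComplexOrder

/-! ### Quantum Fisher information and the commutator -/

/-- The Hilbert-Schmidt norm is invariant under unitary conjugation. -/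
theorem sum_norm_sq_unitary_conj {ι : Type*} [Fintype ι] [DecidableEq ι]
    (U : Matrix.unitaryGroup ι ℂ) (X : Matrix ι ι ℂ) :
    ∑ k, ∑ l, ‖(star (U : Matrix ι ι ℂ) * X * (U : Matrix ι ι ℂ)) k l‖ ^ 2
      = ∑ k, ∑ l, ‖X k l‖ ^ 2 := by
  have key (Y : Matrix ι ι ℂ) :
      ((∑ k, ∑ l, ‖Y k l‖ ^ 2 : ℝ) : ℂ) = (Y * star Y).trace := by
    simp [Matrix.trace, Matrix.mul_apply, Matrix.star_apply, Complex.mul_conj,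
      Complex.normSq_eq_norm_sq]
  have hU : (U : Matrix ι ι ℂ) * star (U : Matrix ι ι ℂ) = 1 := Unitary.mul_star_self_of_mem U.2
  apply Complex.ofReal_injective
  rw [key, key]
  calc _ = (star (U : Matrix ι ι ℂ) * (X * ((U : Matrix ι ι ℂ) * star (U : Matrix ι ι ℂ))
          * star X * (U : Matrix ι ι ℂ))).trace := by
        simp only [star_mul, star_star, Matrix.mul_assoc]
    _ = _ := by
        rw [Matrix.trace_mul_comm, hU, Matrix.mul_one, Matrix.mul_assoc, hU, Matrix.mul_one]

/-- In an eigenbasis of `ρ` the commutator has entries `(p_k - p_l) ⟨k|H|l⟩`, and for `k ≠ l` the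
denominator `p_k + p_l` is at most the trace of `ρ`. -/
theorem two_mul_sum_norm_commutator_sq_le_qfi {ι : Type*} [Fintype ι] [DecidableEq ι]
    {ρ : Matrix ι ι ℂ} (hρ : ρ.IsHermitian) (hpos : ρ.PosSemidef)
    (htr : ρ.trace.re ≤ 1) (H : Matrix ι ι ℂ) :
    2 * ∑ k, ∑ l, ‖(ρ * H - H * ρ) k l‖ ^ 2 ≤ qfi hρ H := by
  set U := hρ.eigenvectorUnitary with hU
  set p := hρ.eigenvalues with hp
  have hp0 : ∀ k, 0 ≤ p k := hpos.eigenvalues_nonneg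
  have hsum : ∑ k, p k ≤ 1 := by
    have h := hρ.trace_eq_sum_eigenvalues
    rw [h] at htr
    simpa using htr
  have hUU : star (U : Matrix ι ι ℂ) * (U : Matrix ι ι ℂ) = 1 :=
    Unitary.star_mul_self_of_mem U.2
  have hspec : ρ = (U : Matrix ι ι ℂ) * Matrix.diagonal (fun k => (p k : ℂ))
      * star (U : Matrix ι ι ℂ) := hρ.spectral_theorem
  have hcomm (k l : ι) : (star (U : Matrix ι ι ℂ) * (ρ * H - H * ρ) * (U : Matrix ι ι ℂ)) k l
      = ((p k - p l : ℝ) : ℂ) * (star (U : Matrix ι ι ℂ) * H * (U : Matrix ι ι ℂ)) k l := by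
    have : star (U : Matrix ι ι ℂ) * (ρ * H - H * ρ) * (U : Matrix ι ι ℂ)
        = Matrix.diagonal (fun k => (p k : ℂ)) * (star (U : Matrix ι ι ℂ) * H * U)
          - (star (U : Matrix ι ι ℂ) * H * U) * Matrix.diagonal (fun k => (p k : ℂ)) := by
      set D := Matrix.diagonal (fun k => (p k : ℂ))
      rw [hspec]
      calc _ = (star (U : Matrix ι ι ℂ) * U) * D * (star (U : Matrix ι ι ℂ) * H * U)
            - (star (U : Matrix ι ι ℂ) * H * U) * D * (star (U : Matrix ι ι ℂ) * U) := by
            noncomm_ring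
        _ = _ := by rw [hUU, Matrix.one_mul, Matrix.mul_one]
    rw [this, Matrix.sub_apply, Matrix.diagonal_mul, Matrix.mul_diagonal]
    push_cast
    ring
  rw [← sum_norm_sq_unitary_conj U]
  unfold qfi
  refine mul_le_mul_of_nonneg_left (sum_le_sum fun k _ => sum_le_sum fun l _ => ?_) zero_le_two
  rw [hcomm, norm_mul, mul_pow, Complex.norm_real, Real.norm_eq_abs, sq_abs]
  split_ifs with h0
  · have hk : p k = 0 := by linarith [hp0 k, hp0 l]
    have hl : p l = 0 := by linarith [hp0 k, hp0 l]
    simp [hk, hl]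
  · refine mul_le_mul_of_nonneg_right ?_ (sq_nonneg _)
    have hs : 0 < p k + p l := lt_of_le_of_ne (add_nonneg (hp0 k) (hp0 l)) (Ne.symm h0)
    rcases eq_or_ne k l with rfl | hkl
    · simp
    · have hle : p k + p l ≤ 1 := by
        rw [← sum_pair hkl]
        exact (sum_le_sum_of_subset_of_nonneg (subset_univ _) fun i _ _ => hp0 i).trans hsum
      rw [le_div_iff₀ hs]
      exact mul_le_of_le_one_right (sq_nonneg _) hle

/-! ### Hamming weights -/

theorem generator_eq_diagonal (M : ℕ) :
    generator M = Matrix.diagonal fun x => ((M - 2 * weight x : ℝ) : ℂ) := by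
  have h (v : Fin 2) : (-1 : ℂ) ^ (v : ℕ) = 1 - 2 * ((v : ℕ) : ℂ) := by
    fin_cases v <;> norm_num
  ext x y
  rw [generator, Matrix.sum_apply]
  rcases eq_or_ne x y with rfl | hxy
  · simp [pauliZ, h, weight, mul_sum]
  · simp [pauliZ, hxy]

theorem card_weight_eq (M w : ℕ) : #{x : Bits M | weight x = w} = M.choose w := by
  -- A bit string corresponds to its support, and its weight to the size of the support.
  trans #(powersetCard w (univ : Finset (Fin M)))
  swap
  · simp
  refine card_bij' (fun x _ => univ.filter fun i => x i = 1)
    (fun s _ i => if i ∈ s then 1 else 0) ?_ ?_ ?_ ?_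
  · intro x hx
    have h (v : Fin 2) : (v : ℕ) = if v = 1 then 1 else 0 := by fin_cases v <;> rfl
    simp only [mem_filter, mem_univ, true_and] at hx
    simp only [mem_powersetCard, subset_univ, true_and, card_filter]
    rw [← hx]
    exact sum_congr rfl fun i _ => (h _).symm
  · intro s hs
    simp only [mem_powersetCard, subset_univ, true_and] at hs
    simp [weight, ← hs, apply_ite]
  · intro x _
    ext i
    have h (v : Fin 2) : v = if v = 1 then 1 else 0 := by fin_cases v <;> rfl
    simp only [mem_filter, mem_univ, true_and]
    rw [← h]
  · intro s _
    ext i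
    simp

theorem weight_le {M : ℕ} (x : Bits M) : weight x ≤ M :=
  (sum_le_card_nsmul univ (fun i => (x i : ℕ)) 1 fun i _ => by omega).trans (by simp)

theorem sum_comp_weight (M : ℕ) (F : ℕ → ℝ) :
    ∑ x : Bits M, F (weight x) = ∑ w ∈ range (M + 1), (M.choose w : ℝ) * F w := by
  rw [← sum_fiberwise_of_maps_to (g := fun x : Bits M => weight x) (t := range (M + 1))
    fun x _ => mem_range_succ_iff.2 (weight_le x)]
  refine sum_congr rfl fun w _ => ?_
  rw [sum_congr rfl fun x hx => by rw [(mem_filter.1 hx).2], sum_const, card_weight_eq,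
    nsmul_eq_mul]

theorem weight_join {N t : ℕ} (h : t ≤ N) (x : Bits t) (y : Bits (N - t)) :
    weight (join x y) = weight x + weight y := by
  unfold weight
  rw [← (finSumFinEquiv.trans (finCongr (Nat.add_sub_cancel' h))).sum_comp,
    Fintype.sum_sum_type]
  simp [join]

theorem join_injective {N t : ℕ} (h : t ≤ N) :
    Function.Injective fun p : Bits t × Bits (N - t) => (join p.1 p.2 : Bits N) := by
  rintro ⟨x, y⟩ ⟨x', y'⟩ hp
  have hp' := congrFun hp
  ext i
  · simpa [join] using congrArg Fin.val (hp' ⟨i, by omega⟩)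
  · simpa [join] using congrArg Fin.val (hp' ⟨t + i, by omega⟩)

/-! ### The probe state and the erased state -/

/-- The amplitude of the probe state at a basis state of Hamming weight `w`; the probe state is
symmetric, so `w` determines it. It vanishes unless `w = g * j` for some `j ≤ n`. -/
def amplitude (g n N w : ℕ) : ℝ :=
  ∑ j ∈ range (n + 1),
    if w = g * j then √(1 / 2 ^ n : ℝ) * √(n.choose j : ℝ) * (1 / √(N.choose w : ℝ)) else 0

theorem probe_apply (g n N : ℕ) (z : Bits N) :
    probe g n N z = (amplitude g n N (weight z) : ℂ) := by
  simp only [probe, amplitude, Finset.sum_apply, Pi.smul_apply, dicke, smul_eq_mul,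
    Complex.ofReal_sum]
  refine sum_congr rfl fun j _ => ?_
  split_ifs with h
  · rw [h]; push_cast; ring
  · simp

theorem amplitude_nonneg (g n N w : ℕ) : 0 ≤ amplitude g n N w :=
  sum_nonneg fun j _ => by split_ifs <;> positivity

theorem amplitude_sq {g n j : ℕ} (N : ℕ) (hg : 0 < g) (hj : j ≤ n) :
    amplitude g n N (g * j) ^ 2 = (n.choose j : ℝ) / 2 ^ n / (N.choose (g * j) : ℝ) := by
  have : amplitude g n N (g * j)
      = √(1 / 2 ^ n : ℝ) * √(n.choose j : ℝ) * (1 / √(N.choose (g * j) : ℝ)) := by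
    rw [amplitude, sum_eq_single_of_mem j (mem_range_succ_iff.2 hj), if_pos rfl]
    intro i _ hij
    rw [if_neg fun h => hij (Nat.eq_of_mul_eq_mul_left hg h).symm]
  rw [this, mul_pow, mul_pow, div_pow, Real.sq_sqrt (by positivity), Real.sq_sqrt (by positivity),
    Real.sq_sqrt (by positivity)]
  ring

theorem amplitude_eq_zero {g n N w : ℕ} (h : ∀ j ≤ n, w ≠ g * j) : amplitude g n N w = 0 :=
  sum_eq_zero fun j hj => if_neg (h j (mem_range_succ_iff.1 hj))

theorem sum_amplitude_sq {g n N : ℕ} (hg : 0 < g) (hN : N = g * n) :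
    ∑ z : Bits N, amplitude g n N (weight z) ^ 2 = 1 := by
  rw [sum_comp_weight N fun w => amplitude g n N w ^ 2]
  have hsub : (range (n + 1)).image (g * ·) ⊆ range (N + 1) := by
    intro w hw
    obtain ⟨j, hj, rfl⟩ := mem_image.1 hw
    rw [mem_range_succ_iff] at hj ⊢
    exact hN ▸ Nat.mul_le_mul_left g hj
  rw [← sum_subset hsub, sum_image fun i _ j _ h => Nat.eq_of_mul_eq_mul_left hg h]
  · have h2 : ∑ j ∈ range (n + 1), (n.choose j : ℝ) = 2 ^ n := mod_cast Nat.sum_range_choose n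
    calc _ = ∑ j ∈ range (n + 1), (n.choose j : ℝ) / 2 ^ n := by
          refine sum_congr rfl fun j hj => ?_
          rw [mem_range_succ_iff] at hj
          have hpos : (0 : ℝ) < N.choose (g * j) :=
            mod_cast Nat.choose_pos (hN ▸ Nat.mul_le_mul_left g hj)
          rw [amplitude_sq N hg hj]
          field_simp
      _ = 1 := by rw [← sum_div, h2, div_self (by positivity)]
  · intro w _ hw
    rw [amplitude_eq_zero fun j hj h => hw (mem_image.2 ⟨j, mem_range_succ_iff.2 hj, h.symm⟩)]
    simp

theorem erased_apply {g n N t : ℕ} (h : t ≤ N) (y y' : Bits (N - t)) :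
    erased g n N t y y' = ((∑ u ∈ range (t + 1), (t.choose u : ℝ) *
      (amplitude g n N (u + weight y) * amplitude g n N (u + weight y')) : ℝ) : ℂ) := by
  rw [← sum_comp_weight t fun u =>
    amplitude g n N (u + weight y) * amplitude g n N (u + weight y')]
  simp [erased, traceFirst, pureState, Matrix.vecMulVec_apply, probe_apply, weight_join h]

theorem erased_posSemidef (g n N t : ℕ) : (erased g n N t).PosSemidef := by
  have : erased g n N t = ∑ x : Bits t, Matrix.vecMulVec (fun y => probe g n N (join x y))
      (star fun y => probe g n N (join x y)) := by
    ext y y'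
    simp [erased, traceFirst, pureState, Matrix.vecMulVec_apply, Matrix.sum_apply]
  rw [this]
  exact Matrix.posSemidef_sum _ fun x _ => Matrix.posSemidef_vecMulVec_self_star _

theorem trace_erased_le_one {g n N t : ℕ} (hg : 0 < g) (hN : N = g * n) (h : t ≤ N) :
    (erased g n N t).trace.re ≤ 1 := by
  have : (erased g n N t).trace.re = ∑ p : Bits t × Bits (N - t),
      amplitude g n N (weight (join p.1 p.2 : Bits N)) ^ 2 := by
    rw [Fintype.sum_prod_type, sum_comm]
    simp [Matrix.trace, erased, traceFirst, pureState, Matrix.vecMulVec_apply, probe_apply, sq]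
  rw [this, ← sum_amplitude_sq hg hN]
  refine (sum_map univ ⟨_, join_injective h⟩
    fun z : Bits N => amplitude g n N (weight z) ^ 2).symm.trans_le ?_
  exact sum_le_sum_of_subset_of_nonneg (subset_univ _) fun _ _ _ => sq_nonneg _

/-! ### Reduction to a sum over weights -/

theorem sum_choose_sq_mul_le_qfi {g n N t : ℕ} (hg : 0 < g) (hN : N = g * n) (h : t ≤ N) :
    8 * ∑ u ∈ range (t + 1), (t.choose u : ℝ) ^ 2 *
        ∑ w ∈ range (N - t + 1), (N - t).choose w * amplitude g n N (u + w) ^ 2 *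
          ∑ w' ∈ range (N - t + 1), (N - t).choose w' * amplitude g n N (u + w') ^ 2 *
            ((w : ℝ) - w') ^ 2
      ≤ qfi (erased_isHermitian g n N t) (generator (N - t)) := by
  refine le_trans ?_ (two_mul_sum_norm_commutator_sq_le_qfi _ (erased_posSemidef g n N t)
    (trace_erased_le_one hg hN h) _)
  have hentry (y y' : Bits (N - t)) :
      4 * ∑ u ∈ range (t + 1), (t.choose u : ℝ) ^ 2 * (amplitude g n N (u + weight y) ^ 2 *
        (amplitude g n N (u + weight y') ^ 2 * ((weight y : ℝ) - weight y') ^ 2))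
      ≤ ‖(erased g n N t * generator (N - t) - generator (N - t) * erased g n N t) y y'‖ ^ 2 := by
    rw [generator_eq_diagonal, Matrix.sub_apply, Matrix.mul_diagonal, Matrix.diagonal_mul,
      erased_apply h, ← Complex.ofReal_mul, ← Complex.ofReal_mul, ← Complex.ofReal_sub,
      Complex.norm_real, Real.norm_eq_abs, sq_abs]
    have hsq := sum_sq_le_sq_sum_of_nonneg (s := range (t + 1))
      (f := fun u => (t.choose u : ℝ) *
        (amplitude g n N (u + weight y) * amplitude g n N (u + weight y')))
      fun u _ => mul_nonneg (Nat.cast_nonneg _)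
        (mul_nonneg (amplitude_nonneg ..) (amplitude_nonneg ..))
    calc _ = (∑ u ∈ range (t + 1), ((t.choose u : ℝ) *
          (amplitude g n N (u + weight y) * amplitude g n N (u + weight y'))) ^ 2)
            * (4 * ((weight y : ℝ) - weight y') ^ 2) := by
          rw [mul_sum, sum_mul]
          exact sum_congr rfl fun u _ => by ring
      _ ≤ _ := mul_le_mul_of_nonneg_right hsq (by positivity)
      _ = _ := by ring
  calc _ = 2 * ∑ y : Bits (N - t), ∑ y' : Bits (N - t),
        4 * ∑ u ∈ range (t + 1), (t.choose u : ℝ) ^ 2 * (amplitude g n N (u + weight y) ^ 2 *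
          (amplitude g n N (u + weight y') ^ 2 * ((weight y : ℝ) - weight y') ^ 2)) := by
        simp_rw [← mul_sum, sum_comm (s := univ) (t := range (t + 1)), ← mul_sum]
        rw [← mul_assoc]
        norm_num only
        congr 1
        refine sum_congr rfl fun u _ => ?_
        congr 1
        rw [sum_comp_weight (N - t) fun w => amplitude g n N (u + w) ^ 2 *
          ∑ y' : Bits (N - t), amplitude g n N (u + weight y') ^ 2 * ((w : ℝ) - weight y') ^ 2]
        refine sum_congr rfl fun w _ => ?_
        rw [sum_comp_weight (N - t) fun w' => amplitude g n N (u + w') ^ 2 * ((w : ℝ) - w') ^ 2]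
        simp_rw [mul_assoc]
    _ ≤ _ := mul_le_mul_of_nonneg_left
        (sum_le_sum fun y _ => sum_le_sum fun y' _ => hentry y y') zero_le_two

theorem lt_and_sub_lt_of_mem_Ico {g n N t j u : ℕ} (hN : N = g * n) (ht : t < g) (hu : u ≤ t)
    (hj : j ∈ Ico 1 n) : u < g * j ∧ g * j - u < N - t := by
  obtain ⟨h1, h2⟩ := mem_Ico.1 hj
  have := Nat.mul_le_mul_left g h1
  have := Nat.mul_le_mul_left g h2
  rw [Nat.mul_succ, ← hN] at this
  omega

theorem a_nonneg (g n N t j u : ℕ) : 0 ≤ a g n N t j u := by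
  unfold a; positivity

/-- The measure on weights with density `binom(N-t,w) r(u+w)²`, `r` the amplitude of the probe
state, has mass at least `a_{j,u}` at each interior weight `gj - u`. The endpoints `j = 0` and
`j = n` have weights within `0, ..., N - t` only for `u = 0` and `u = t` respectively, and then
carry the mass `2^(-n)`. -/
theorem le_sum_choose_mul_amplitude_sq {g n N t u : ℕ} (hg : 0 < g) (hn : 0 < n)
    (hN : N = g * n) (ht : t < g) (hu : u ≤ t) {G : ℕ → ℝ} (hG : ∀ w, 0 ≤ G w) :
    (if u = 0 then 1 / 2 ^ n else 0) * G 0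
        + ∑ j ∈ Ico 1 n, a g n N t j u * G (g * j - u)
        + (if u = t then 1 / 2 ^ n else 0) * G (N - t)
      ≤ ∑ w ∈ range (N - t + 1), (N - t).choose w * amplitude g n N (u + w) ^ 2 * G w := by
  have hgN : g ≤ N := hN ▸ Nat.le_mul_of_pos_right g hn
  have hterm (w : ℕ) : 0 ≤ (N - t).choose w * amplitude g n N (u + w) ^ 2 * G w :=
    mul_nonneg (by positivity) (hG w)
  have h0 : (if u = 0 then 1 / 2 ^ n else 0) * G 0
      ≤ (N - t).choose 0 * amplitude g n N (u + 0) ^ 2 * G 0 := by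
    split_ifs with h
    · have := amplitude_sq N hg (Nat.zero_le n)
      rw [h, show 0 + 0 = g * 0 by simp, this]
      simp
    · simpa using hterm 0
  have h1 : (if u = t then 1 / 2 ^ n else 0) * G (N - t)
      ≤ (N - t).choose (N - t) * amplitude g n N (u + (N - t)) ^ 2 * G (N - t) := by
    split_ifs with h
    · have := amplitude_sq N hg (le_refl n)
      rw [h, show t + (N - t) = g * n by omega, this, ← hN]
      simp
    · simpa using hterm (N - t)
  have hmid : ∑ j ∈ Ico 1 n, a g n N t j u * G (g * j - u)
      ≤ ∑ w ∈ Ico 1 (N - t), (N - t).choose w * amplitude g n N (u + w) ^ 2 * G w := by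
    have hinj : Set.InjOn (fun j => g * j - u) (Ico 1 n) := by
      intro i hi j hj hij
      have h1 := (lt_and_sub_lt_of_mem_Ico hN ht hu hi).1
      have h2 := (lt_and_sub_lt_of_mem_Ico hN ht hu hj).1
      simp only at hij
      exact Nat.eq_of_mul_eq_mul_left hg (by omega)
    calc _ = ∑ w ∈ (Ico 1 n).image (fun j => g * j - u),
          (N - t).choose w * amplitude g n N (u + w) ^ 2 * G w := by
          rw [sum_image hinj]
          refine sum_congr rfl fun j hj => ?_
          have h1 := (lt_and_sub_lt_of_mem_Ico hN ht hu hj).1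
          rw [Nat.add_sub_cancel' h1.le, amplitude_sq N hg (mem_Ico.1 hj).2.le, a]
          ring
      _ ≤ _ := sum_le_sum_of_subset_of_nonneg (fun w hw => by
          obtain ⟨j, hj, rfl⟩ := mem_image.1 hw
          have := lt_and_sub_lt_of_mem_Ico hN ht hu hj
          exact mem_Ico.2 ⟨by omega, this.2⟩) fun w _ _ => hterm w
  rw [sum_range_succ, range_eq_Ico,
    sum_eq_sum_Ico_succ_bot (by omega : 0 < N - t)]
  exact add_le_add (add_le_add h0 hmid) h1

/-- The double sum of `(w - w')²` over the weight measure for `u`, bounded below by its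
interior-interior and interior-endpoint parts. -/
theorem le_sum_sum_choose_mul_amplitude_sq {g n N t u : ℕ} (hg : 0 < g) (hn : 0 < n)
    (hN : N = g * n) (ht : t < g) (hu : u ≤ t) :
    ∑ i ∈ Ico 1 n, a g n N t i u * ∑ j ∈ Ico 1 n, a g n N t j u *
          (((g * i - u : ℕ) : ℝ) - (g * j - u : ℕ)) ^ 2
        + (if u = 0 then 1 / 2 ^ n else 0) *
          (2 * ∑ j ∈ Ico 1 n, a g n N t j u * ((g * j - u : ℕ) : ℝ) ^ 2)
        + (if u = t then 1 / 2 ^ n else 0) *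
          (2 * ∑ j ∈ Ico 1 n, a g n N t j u * (((N - t : ℕ) : ℝ) - (g * j - u : ℕ)) ^ 2)
      ≤ ∑ w ∈ range (N - t + 1), (N - t).choose w * amplitude g n N (u + w) ^ 2 *
          ∑ w' ∈ range (N - t + 1), (N - t).choose w' * amplitude g n N (u + w') ^ 2 *
            ((w : ℝ) - w') ^ 2 := by
  have hinner (w : ℕ) := le_sum_choose_mul_amplitude_sq hg hn hN ht hu
    (G := fun w' => ((w : ℝ) - w') ^ 2) fun w' => sq_nonneg _
  have houter := le_sum_choose_mul_amplitude_sq hg hn hN ht hu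
    (G := fun w => ∑ w' ∈ range (N - t + 1), (N - t).choose w' * amplitude g n N (u + w') ^ 2 *
      ((w : ℝ) - w') ^ 2) fun w => sum_nonneg fun w' _ => by positivity
  refine le_trans ?_ houter
  set x : ℝ := if u = 0 then 1 / 2 ^ n else 0 with hx
  set y : ℝ := if u = t then 1 / 2 ^ n else 0 with hy
  have hx0 : 0 ≤ x := by rw [hx]; split_ifs <;> positivity
  have hy0 : 0 ≤ y := by rw [hy]; split_ifs <;> positivity
  have e0 := mul_le_mul_of_nonneg_left (hinner 0) hx0
  have e1 := mul_le_mul_of_nonneg_left (hinner (N - t)) hy0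
  have em := sum_le_sum (s := Ico 1 n) fun i _ =>
    mul_le_mul_of_nonneg_left (hinner (g * i - u)) (a_nonneg g n N t i u)
  refine le_trans ?_ (add_le_add (add_le_add e0 em) e1)
  simp only [mul_add, sum_add_distrib, Nat.cast_zero, zero_sub, sub_zero, neg_sq, sub_self]
  have s0 : ∑ i ∈ Ico 1 n, a g n N t i u * (x * ((g * i - u : ℕ) : ℝ) ^ 2)
      = x * ∑ i ∈ Ico 1 n, a g n N t i u * ((g * i - u : ℕ) : ℝ) ^ 2 := by
    rw [mul_sum]
    exact sum_congr rfl fun i _ => by ring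
  have s1 : ∑ i ∈ Ico 1 n, a g n N t i u * (y * (((g * i - u : ℕ) : ℝ) - (N - t : ℕ)) ^ 2)
      = y * ∑ i ∈ Ico 1 n, a g n N t i u * (((N - t : ℕ) : ℝ) - (g * i - u : ℕ)) ^ 2 := by
    rw [mul_sum]
    exact sum_congr rfl fun i _ => by ring
  rw [s0, s1]
  -- The endpoint-endpoint terms, present only for `u = t = 0`, are discarded.
  have : 0 ≤ x * (y * ((N - t : ℕ) : ℝ) ^ 2) := by positivity
  have : 0 ≤ y * (x * ((N - t : ℕ) : ℝ) ^ 2) := by positivity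
  simp only [zero_pow two_ne_zero, mul_zero]
  linarith

/-! ### Moments of the interior weights -/

theorem two_mul_weight_eq {g n N t j u : ℕ} (hN : N = g * n) (ht : t < g) (hu : u ≤ t)
    (hj : j ∈ Ico 1 n) :
    2 * ((g * j - u : ℕ) : ℝ) = ((N : ℝ) - t) * c g N t j u := by
  obtain ⟨h1, h2⟩ := lt_and_sub_lt_of_mem_Ico hN ht hu hj
  have hM : (0 : ℝ) < (N : ℝ) - t := by
    rw [sub_pos]; exact_mod_cast (by omega : t < N)
  rw [Nat.cast_sub h1.le, c]
  push_cast
  field_simp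

/-- With `M = N - t` and `w = gj - u`, this is `4 w² = 4 M w - 4 w (M - w)`. An interior weight
exists only if `M ≥ 2`, so the denominator `M - 1` in `b` is nonzero. -/
theorem four_mul_weight_sq_eq {g n N t j u : ℕ} (hN : N = g * n) (ht : t < g) (hu : u ≤ t)
    (hj : j ∈ Ico 1 n) :
    4 * ((g * j - u : ℕ) : ℝ) ^ 2
      = ((N : ℝ) - t) ^ 2 * (2 * c g N t j u - (1 - 1 / ((N : ℝ) - t)) * b g N t j u) := by
  obtain ⟨h1, h2⟩ := lt_and_sub_lt_of_mem_Ico hN ht hu hj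
  have hM : (0 : ℝ) < (N : ℝ) - t := by
    rw [sub_pos]; exact_mod_cast (by omega : t < N)
  have hM1 : (0 : ℝ) < (N : ℝ) - t - 1 := by
    rw [sub_sub, sub_pos]; exact_mod_cast (by omega : t + 1 < N)
  rw [Nat.cast_sub h1.le, c, b]
  push_cast
  field_simp
  ring

theorem sum_a_mul_weight {g n N t u : ℕ} (hN : N = g * n) (ht : t < g) (hu : u ≤ t) :
    2 * ∑ j ∈ Ico 1 n, a g n N t j u * ((g * j - u : ℕ) : ℝ) = ((N : ℝ) - t) * C g n N t u := by
  rw [C, mul_sum, mul_sum]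
  refine sum_congr rfl fun j hj => ?_
  linear_combination a g n N t j u * two_mul_weight_eq hN ht hu hj

theorem sum_a_mul_weight_sq {g n N t u : ℕ} (hN : N = g * n) (ht : t < g) (hu : u ≤ t) :
    4 * ∑ j ∈ Ico 1 n, a g n N t j u * ((g * j - u : ℕ) : ℝ) ^ 2
      = ((N : ℝ) - t) ^ 2 * (2 * C g n N t u - (1 - 1 / ((N : ℝ) - t)) * B g n N t u) := by
  rw [C, B, mul_sum, mul_sum, mul_sum, ← sum_sub_distrib, mul_sum]
  refine sum_congr rfl fun j hj => ?_
  linear_combination a g n N t j u * four_mul_weight_sq_eq hN ht hu hj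

theorem sum_a_mul_coweight_sq {g n N t u : ℕ} (hN : N = g * n) (ht : t < g) (hu : u ≤ t)
    (h : t ≤ N) :
    4 * ∑ j ∈ Ico 1 n, a g n N t j u * (((N - t : ℕ) : ℝ) - (g * j - u : ℕ)) ^ 2
      = ((N : ℝ) - t) ^ 2 *
        (4 * A g n N t u - 2 * C g n N t u - (1 - 1 / ((N : ℝ) - t)) * B g n N t u) := by
  have e : ∑ j ∈ Ico 1 n, a g n N t j u * (((N - t : ℕ) : ℝ) - (g * j - u : ℕ)) ^ 2
      = ((N : ℝ) - t) ^ 2 * A g n N t u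
        - 2 * ((N : ℝ) - t) * ∑ j ∈ Ico 1 n, a g n N t j u * ((g * j - u : ℕ) : ℝ)
        + ∑ j ∈ Ico 1 n, a g n N t j u * ((g * j - u : ℕ) : ℝ) ^ 2 := by
    rw [A, mul_sum, mul_sum, ← sum_sub_distrib, ← sum_add_distrib, Nat.cast_sub h]
    exact sum_congr rfl fun j _ => by ring
  linear_combination 4 * e - 4 * ((N : ℝ) - t) * sum_a_mul_weight (u := u) hN ht hu
    + sum_a_mul_weight_sq (u := u) hN ht hu

/-- The double sum is twice the zeroth moment times the second, minus twice the square of the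
first. -/
theorem sum_sum_a_mul_sq_sub {g n N t u : ℕ} (hN : N = g * n) (ht : t < g) (hu : u ≤ t) :
    2 * ∑ i ∈ Ico 1 n, a g n N t i u * ∑ j ∈ Ico 1 n, a g n N t j u *
          (((g * i - u : ℕ) : ℝ) - (g * j - u : ℕ)) ^ 2
      = ((N : ℝ) - t) ^ 2 * K g n N t u := by
  set S := ∑ j ∈ Ico 1 n, a g n N t j u * ((g * j - u : ℕ) : ℝ) with hS
  set T := ∑ j ∈ Ico 1 n, a g n N t j u * ((g * j - u : ℕ) : ℝ) ^ 2 with hT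
  have e (x : ℝ) : ∑ j ∈ Ico 1 n, a g n N t j u * (x - (g * j - u : ℕ)) ^ 2
      = x ^ 2 * A g n N t u - 2 * x * S + T := by
    rw [A, hS, hT, mul_sum, mul_sum, ← sum_sub_distrib, ← sum_add_distrib]
    exact sum_congr rfl fun j _ => by ring
  have e2 : ∑ i ∈ Ico 1 n, a g n N t i u * ∑ j ∈ Ico 1 n, a g n N t j u *
        (((g * i - u : ℕ) : ℝ) - (g * j - u : ℕ)) ^ 2
      = A g n N t u * T - 2 * S * S + T * A g n N t u := by
    simp_rw [e]
    have : ∀ i ∈ Ico 1 n, a g n N t i u * (((g * i - u : ℕ) : ℝ) ^ 2 * A g n N t u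
        - 2 * ((g * i - u : ℕ) : ℝ) * S + T)
        = A g n N t u * (a g n N t i u * ((g * i - u : ℕ) : ℝ) ^ 2)
          - 2 * S * (a g n N t i u * ((g * i - u : ℕ) : ℝ)) + T * a g n N t i u :=
      fun i _ => by ring
    rw [sum_congr rfl this, sum_add_distrib, sum_sub_distrib, ← mul_sum, ← mul_sum, ← mul_sum,
      ← hS, ← hT, ← A]
  have eS := sum_a_mul_weight (u := u) hN ht hu
  have eT := sum_a_mul_weight_sq (u := u) hN ht hu
  rw [← hS] at eS
  rw [← hT] at eT
  rw [e2, K]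
  linear_combination A g n N t u * eT - (2 * S + ((N : ℝ) - t) * C g n N t u) * eS

end GnuProbe

end

/-! ### The lower bound -/

open GnuProbe in
theorem theorem1 (g n N t : ℕ) (hg : 0 < g) (hn : 0 < n) (hN : N = g * n) (ht : t < g) :
    2 * ((N : ℝ) - t) ^ 2 / 2 ^ n *
          (4 * GnuProbe.A g n N t t - GnuProbe.B g n N t 0 - GnuProbe.B g n N t t
            + 2 * GnuProbe.C g n N t 0 - 2 * GnuProbe.C g n N t t)
        + 2 * ((N : ℝ) - t) / 2 ^ n * (GnuProbe.B g n N t 0 + GnuProbe.B g n N t t)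
        + 2 * ((N : ℝ) - t) ^ 2 *
          ∑ u ∈ Finset.range (t + 1), (t.choose u : ℝ) ^ 2 * GnuProbe.K g n N t u
      ≤ GnuProbe.qfi (GnuProbe.erased_isHermitian g n N t) (GnuProbe.generator (N - t)) := by
  have htN : t < N := ht.trans_le (hN ▸ Nat.le_mul_of_pos_right g hn)
  have hM : (N : ℝ) - t ≠ 0 := by
    rw [sub_ne_zero]; exact_mod_cast htN.ne'
  refine le_trans ?_ (sum_choose_sq_mul_le_qfi hg hN htN.le)
  have hsum := Finset.sum_le_sum (s := Finset.range (t + 1)) fun u hu => mul_le_mul_of_nonneg_left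
    (le_sum_sum_choose_mul_amplitude_sq hg hn hN ht (Finset.mem_range_succ_iff.1 hu))
    (sq_nonneg (t.choose u : ℝ))
  refine le_trans ?_ (mul_le_mul_of_nonneg_left hsum (by norm_num : (0 : ℝ) ≤ 8))
  -- The interior pairs give twice the sum over `u` in the claim.
  have hK : ((N : ℝ) - t) ^ 2 * ∑ u ∈ Finset.range (t + 1), (t.choose u : ℝ) ^ 2 * K g n N t u
      = 2 * ∑ u ∈ Finset.range (t + 1), (t.choose u : ℝ) ^ 2 *
        ∑ i ∈ Finset.Ico 1 n, a g n N t i u * ∑ j ∈ Finset.Ico 1 n, a g n N t j u *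
          (((g * i - u : ℕ) : ℝ) - (g * j - u : ℕ)) ^ 2 := by
    rw [Finset.mul_sum, Finset.mul_sum]
    refine Finset.sum_congr rfl fun u hu => ?_
    linear_combination -(t.choose u : ℝ) ^ 2 *
      sum_sum_a_mul_sq_sub hN ht (Finset.mem_range_succ_iff.1 hu)
  have hD : 0 ≤ ∑ u ∈ Finset.range (t + 1), (t.choose u : ℝ) ^ 2 *
        ∑ i ∈ Finset.Ico 1 n, a g n N t i u * ∑ j ∈ Finset.Ico 1 n, a g n N t j u *
          (((g * i - u : ℕ) : ℝ) - (g * j - u : ℕ)) ^ 2 :=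
    Finset.sum_nonneg fun u _ => mul_nonneg (sq_nonneg _) <| Finset.sum_nonneg fun i _ =>
      mul_nonneg (a_nonneg ..) <| Finset.sum_nonneg fun j _ =>
        mul_nonneg (a_nonneg ..) (sq_nonneg _)
  have hX : 0 ≤ 1 / 2 ^ n * ∑ j ∈ Finset.Ico 1 n, a g n N t j 0 * ((g * j - 0 : ℕ) : ℝ) ^ 2 :=
    mul_nonneg (by positivity) <| Finset.sum_nonneg fun j _ =>
      mul_nonneg (a_nonneg ..) (sq_nonneg _)
  have hY : 0 ≤ 1 / 2 ^ n * ∑ j ∈ Finset.Ico 1 n,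
      a g n N t j t * (((N - t : ℕ) : ℝ) - (g * j - t : ℕ)) ^ 2 :=
    mul_nonneg (by positivity) <| Finset.sum_nonneg fun j _ =>
      mul_nonneg (a_nonneg ..) (sq_nonneg _)
  -- The pairs with one extreme weight occur only for `u = 0` and `u = t`.
  have eX := sum_a_mul_weight_sq hN ht (Nat.zero_le t)
  have eY := sum_a_mul_coweight_sq hN ht le_rfl htN.le
  simp only [mul_add, Finset.sum_add_distrib, ite_mul, mul_ite, zero_mul, mul_zero,
    Finset.sum_ite_eq', Finset.mem_range, Nat.succ_pos, Nat.lt_succ_self, if_true,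
    Nat.choose_zero_right, Nat.choose_self, Nat.cast_one, one_pow, one_mul]
  set X := ∑ j ∈ Finset.Ico 1 n, a g n N t j 0 * ((g * j - 0 : ℕ) : ℝ) ^ 2
  set Y := ∑ j ∈ Finset.Ico 1 n, a g n N t j t * (((N - t : ℕ) : ℝ) - (g * j - t : ℕ)) ^ 2
  have hends : 2 * ((N : ℝ) - t) ^ 2 / 2 ^ n *
          (4 * A g n N t t - B g n N t 0 - B g n N t t + 2 * C g n N t 0 - 2 * C g n N t t)
        + 2 * ((N : ℝ) - t) / 2 ^ n * (B g n N t 0 + B g n N t t)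
      = 8 * (1 / 2 ^ n * X) + 8 * (1 / 2 ^ n * Y) := by
    have hMM : ((N : ℝ) - t) ^ 2 * (1 / ((N : ℝ) - t)) = (N : ℝ) - t := by
      field_simp
    linear_combination -2 * (1 / 2 ^ n) * (eX + eY)
      - 2 / 2 ^ n * (B g n N t 0 + B g n N t t) * hMM
  rw [← mul_add, hends]
  linarith
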